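/- Let $d,T\ge 1$ be integers, $b>1$ a real number, $\mathbf{x}_1,\dots,\mathbf{x}_T\in\mathbb{R}^d$ with Euclidean norms $\|\mathbf{x}_t\|\le 1$, and $y_1,\dots,y_T\in\mathbb{R}$. Put $\mathbf{A}_t=b\mathbf{I}+\sum_{s=1}^{t}a_s\mathbf{x}_s\mathbf{x}_s^{\top}$ for $0\le t\le T$, and assume that the weights satisfy $$a_t=\frac{1}{1-\mathbf{x}_t^{\top}\mathbf{A}_{t-1}^{-1}\mathbf{x}_t},\qquad t=1,\dots,T$$ (since $\mathbf{A}_0=b\mathbf{I}$ and $\mathbf{A}_{t-1}$ involves only $a_1,\dots,a_{t-1}$, this determines $a_1,\dots,a_T$ recursively). For $\mathbf{u}\in\mathbb{R}^d$ let $\ell_t(\mathbf{u})=(\mathbf{x}_t^{\top}\mathbf{u}-y_t)^2$, $L_T(\mathbf{u})=\sum_{t=1}^{T}\ell_t(\mathbf{u})$, $L_T^{\boldsymbol a}(\mathbf{u})=\sum_{t=1}^{T}a_t(y_t-\mathbf{u}^{\top}\mathbf{x}_t)^2$ and $S=S(\mathbf{u})=\sup_{1\le t\le T}\ell_t(\mathbf{u})$.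 Then, for every $\mathbf{u}\in\mathbb{R}^d$, $$L_T^{\boldsymbol a}(\mathbf{u})\le L_T(\mathbf{u})+\frac{b}{b-1}\,S\,d\left[1+\ln\left(1+\frac{L_T(\mathbf{u})}{Sd}\right)\right],$$ where the last summand is read as $0$ if $S=0$. -/

import Mathlib

namespace WEMM

/-- Instantaneous squared loss `ℓ_t(u) = (x_tᵀ u - y_t)²`. -/
noncomputable def instLoss {d : ℕ} (x : ℕ → EuclideanSpace ℝ (Fin d)) (y : ℕ → ℝ)
    (t : ℕ) (u : EuclideanSpace ℝ (Fin d)) : ℝ :=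
  (inner ℝ (x t) u - y t) ^ 2

/-- Cumulative loss `L_T(u) = ∑_{t=1}^T ℓ_t(u)`. -/
noncomputable def cumLoss {d : ℕ} (x : ℕ → EuclideanSpace ℝ (Fin d)) (y : ℕ → ℝ)
    (T : ℕ) (u : EuclideanSpace ℝ (Fin d)) : ℝ :=
  ∑ t ∈ Finset.Icc 1 T, instLoss x y t u

/-- Weighted cumulative loss `L_T^a(u) = ∑_{t=1}^T a_t (y_t - uᵀ x_t)²`. -/
noncomputable def weightedLoss {d : ℕ} (a : ℕ → ℝ) (x : ℕ → EuclideanSpace ℝ (Fin d))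
    (y : ℕ → ℝ) (T : ℕ) (u : EuclideanSpace ℝ (Fin d)) : ℝ :=
  ∑ t ∈ Finset.Icc 1 T, a t * (y t - inner ℝ u (x t)) ^ 2

/-- Largest instantaneous loss `S(u) = sup_{1 ≤ t ≤ T} ℓ_t(u)`. -/
noncomputable def supLoss {d : ℕ} (x : ℕ → EuclideanSpace ℝ (Fin d)) (y : ℕ → ℝ)
    (T : ℕ) (u : EuclideanSpace ℝ (Fin d)) : ℝ :=
  sSup ((fun t => instLoss x y t u) '' Set.Icc 1 T)

/-- The matrix `A_t = b I + ∑_{s=1}^t a_s x_s x_sᵀ`; in particular `A_0 = b I`. -/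
noncomputable def A {d : ℕ} (b : ℝ) (a : ℕ → ℝ) (x : ℕ → EuclideanSpace ℝ (Fin d))
    (t : ℕ) : Matrix (Fin d) (Fin d) ℝ :=
  b • (1 : Matrix (Fin d) (Fin d) ℝ) +
    ∑ s ∈ Finset.Icc 1 t, a s • Matrix.vecMulVec (x s).ofLp (x s).ofLp

/-- The quadratic form `x_tᵀ A_{t-1}⁻¹ x_t`, for `t ≥ 1`. -/
noncomputable def invQuad {d : ℕ} (b : ℝ) (a : ℕ → ℝ) (x : ℕ → EuclideanSpace ℝ (Fin d))
    (t : ℕ) : ℝ :=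
  (x t).ofLp ⬝ᵥ ((A b a x (t - 1))⁻¹.mulVec (x t).ofLp)

end WEMM

namespace WEMM

open Matrix

/-! Write q_t for `invQuad b a x t`. Since q_t ≤ 1/b, the excess weight a_t - 1 = q_t/(1 - q_t) is
at most b/(b-1) q_t, so it remains to bound ∑ w_t q_t with w_t = ℓ_t/S ∈ [0,1]. The determinant of
A_T would not see the losses, so A is replaced by the matrices with weights c_t = w_t(1 + q_t). As
c_t ≤ a_t, these are smaller and their inverse forms dominate q_t (`invQuad_anti`); each update then
raises log det by at least w_t q_t (`sum_mul_le_log_det`). Their trace is at most db + 2∑ w_t, and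
AM-GM (`log_det_le`) bounds the final log det. -/

/-- The quadratic forms of the inverses of positive definite matrices are ordered in the reverse
way to those of the matrices. -/
theorem dotProduct_inv_mulVec_anti {n : Type*} [Fintype n] [DecidableEq n] {M N : Matrix n n ℝ}
    (hM : M.PosDef) (hN : N.PosDef) (h : ∀ v, v ⬝ᵥ N *ᵥ v ≤ v ⬝ᵥ M *ᵥ v) (z : n → ℝ) :
    z ⬝ᵥ M⁻¹ *ᵥ z ≤ z ⬝ᵥ N⁻¹ *ᵥ z := by
  have hMv : M *ᵥ (M⁻¹ *ᵥ z) = z := by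
    rw [mulVec_mulVec, mul_nonsing_inv _ ((isUnit_iff_isUnit_det _).1 hM.isUnit), one_mulVec]
  have hNw : N *ᵥ (N⁻¹ *ᵥ z) = z := by
    rw [mulVec_mulVec, mul_nonsing_inv _ ((isUnit_iff_isUnit_det _).1 hN.isUnit), one_mulVec]
  set v := M⁻¹ *ᵥ z
  set w := N⁻¹ *ᵥ z
  -- Expanding gives 2 z·v ≤ v·Nv + z·w, and v·Nv ≤ v·Mv = z·v.
  have h0 := hN.posSemidef.dotProduct_mulVec_nonneg (v - w)
  have hwv : w ⬝ᵥ N *ᵥ v = z ⬝ᵥ v := by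
    have hNt : Nᵀ = N := by simpa [conjTranspose_eq_transpose_of_trivial] using hN.1.eq
    rw [dotProduct_mulVec, ← mulVec_transpose, hNt, hNw]
  have h1 := h v
  rw [hMv, dotProduct_comm v z] at h1
  simp only [star_trivial, mulVec_sub, dotProduct_sub, sub_dotProduct, hNw, hwv,
    dotProduct_comm v z, dotProduct_comm w z] at h0
  linarith

/-- The matrix determinant lemma for a symmetric rank-one update. -/
theorem det_add_smul_vecMulVec {n : Type*} [Fintype n] [DecidableEq n] {M : Matrix n n ℝ}
    (hM : IsUnit M.det) (c : ℝ) (z : n → ℝ) :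
    (M + c • vecMulVec z z).det = M.det * (1 + c * (z ⬝ᵥ M⁻¹ *ᵥ z)) := by
  have h := det_add_replicateCol_mul_replicateRow (ι := Unit) hM (c • z) z
  rw [← vecMulVec_eq, smul_vecMulVec] at h
  rw [h, det_unique (n := Unit)]
  congr 1
  simp only [Matrix.add_apply, one_apply_eq, add_right_inj]
  rw [Matrix.mul_assoc, ← replicateCol_mulVec]
  simp [Matrix.mul_apply, dotProduct, mulVec_smul, Finset.mul_sum]
  exact Finset.sum_congr rfl fun i _ => by ring

/-- A form of the arithmetic-geometric mean inequality for the eigenvalues. -/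
theorem log_det_le {n : Type*} [Fintype n] [DecidableEq n] {M : Matrix n n ℝ}
    (hM : M.PosDef) {m : ℝ} (hm : 0 < m) (h : M.trace ≤ Fintype.card n * m) :
    Real.log M.det ≤ Fintype.card n * Real.log m := by
  have hpos := hM.eigenvalues_pos
  rw [hM.1.trace_eq_sum_eigenvalues] at h
  rw [hM.1.det_eq_prod_eigenvalues]
  simp only [RCLike.ofReal_real_eq_id, id] at h ⊢
  rw [Real.log_prod fun i _ => (hpos i).ne']
  calc ∑ i, Real.log (hM.1.eigenvalues i)
      ≤ ∑ i, (Real.log m - 1 + hM.1.eigenvalues i / m) := by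
        refine Finset.sum_le_sum fun i _ => ?_
        have := Real.log_le_sub_one_of_pos (div_pos (hpos i) hm)
        rw [Real.log_div (hpos i).ne' hm.ne'] at this
        linarith
    _ = Fintype.card n * (Real.log m - 1) + (∑ i, hM.1.eigenvalues i) / m := by
        simp [Finset.sum_add_distrib, Finset.sum_div]
        ring
    _ ≤ Fintype.card n * Real.log m := by
        have := (div_le_iff₀ hm).2 h
        linarith

variable {d : ℕ} {b : ℝ} {a c w : ℕ → ℝ} {x : ℕ → EuclideanSpace ℝ (Fin d)} {t T : ℕ}

theorem A_succ : A b a x (t + 1) =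
    A b a x t + a (t + 1) • vecMulVec (x (t + 1)).ofLp (x (t + 1)).ofLp := by
  rw [A, A, Finset.sum_Icc_succ_top (by omega), add_assoc]

theorem dotProduct_A_mulVec (v : Fin d → ℝ) : v ⬝ᵥ A b a x t *ᵥ v =
    b * (v ⬝ᵥ v) + ∑ s ∈ Finset.Icc 1 t, a s * ((x s).ofLp ⬝ᵥ v) ^ 2 := by
  rw [A, add_mulVec, dotProduct_add, sum_mulVec, dotProduct_sum]
  congr 1
  · simp [smul_mulVec]
  · refine Finset.sum_congr rfl fun s _ => ?_
    rw [smul_mulVec, vecMulVec_mulVec, dotProduct_smul]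
    simp [dotProduct_comm v, pow_two]

theorem A_posDef (hb : 0 < b) (ha : ∀ s ∈ Finset.Icc 1 t, 0 ≤ a s) : (A b a x t).PosDef := by
  refine PosDef.of_dotProduct_mulVec_pos ?_ fun v hv => ?_
  · rw [IsHermitian, conjTranspose_eq_transpose_of_trivial, A]
    simp [transpose_sum, transpose_vecMulVec]
  · rw [star_trivial, dotProduct_A_mulVec]
    have h1 : 0 < v ⬝ᵥ v := by simpa using dotProduct_star_self_pos_iff.2 hv
    have h2 : 0 ≤ ∑ s ∈ Finset.Icc 1 t, a s * ((x s).ofLp ⬝ᵥ v) ^ 2 :=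
      Finset.sum_nonneg fun s hs => mul_nonneg (ha s hs) (sq_nonneg _)
    positivity

theorem dotProduct_self_eq_norm_sq (z : EuclideanSpace ℝ (Fin d)) :
    z.ofLp ⬝ᵥ z.ofLp = ‖z‖ ^ 2 := by
  rw [EuclideanSpace.real_norm_sq_eq]
  simp [dotProduct, pow_two]

theorem trace_A : (A b a x t).trace = d * b + ∑ s ∈ Finset.Icc 1 t, a s * ‖x s‖ ^ 2 := by
  simp [A, trace_sum, trace_vecMulVec, dotProduct_self_eq_norm_sq, mul_comm]

theorem det_A_zero : (A b a x 0).det = b ^ d := by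
  simp [A]

theorem invQuad_nonneg (hb : 0 < b) (ha : ∀ s ∈ Finset.Icc 1 (t - 1), 0 ≤ a s) :
    0 ≤ invQuad b a x t := by
  simpa [invQuad] using (A_posDef hb ha).inv.posSemidef.dotProduct_mulVec_nonneg (x t).ofLp

theorem invQuad_anti (hb : 0 < b) (hc : ∀ s ∈ Finset.Icc 1 (t - 1), 0 ≤ c s)
    (hca : ∀ s ∈ Finset.Icc 1 (t - 1), c s ≤ a s) : invQuad b a x t ≤ invQuad b c x t := by
  refine dotProduct_inv_mulVec_anti
    (A_posDef hb fun s hs => (hc s hs).trans (hca s hs)) (A_posDef hb hc) (fun v => ?_) _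
  rw [dotProduct_A_mulVec, dotProduct_A_mulVec]
  gcongr with s hs
  exact hca s hs

theorem invQuad_le_inv (hb : 0 < b) (ha : ∀ s ∈ Finset.Icc 1 (t - 1), 0 ≤ a s)
    (hx : ‖x t‖ ≤ 1) : invQuad b a x t ≤ 1 / b := by
  -- Zero weights leave only the matrix bI.
  refine (invQuad_anti hb (c := 0) (fun _ _ => le_rfl) ha).trans ?_
  have h : A b 0 x (t - 1) = b • (1 : Matrix (Fin d) (Fin d) ℝ) := by simp [A]
  have hinv : (b • (1 : Matrix (Fin d) (Fin d) ℝ))⁻¹ = b⁻¹ • 1 :=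
    inv_eq_right_inv (by simp [smul_smul, hb.ne'])
  rw [invQuad, h, hinv, smul_mulVec, one_mulVec, dotProduct_smul, dotProduct_self_eq_norm_sq,
    smul_eq_mul, one_div]
  have : ‖x t‖ ^ 2 ≤ 1 := pow_le_one₀ (norm_nonneg _) hx
  exact mul_le_of_le_one_right (by positivity) this

/-- The recursive weights are well defined: the quadratic forms lie in `[0, 1 / b]`. -/
theorem invQuad_mem (hb : 1 < b) (hx : ∀ t ∈ Finset.Icc 1 T, ‖x t‖ ≤ 1)
    (ha : ∀ t ∈ Finset.Icc 1 T, a t = 1 / (1 - invQuad b a x t)) :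
    ∀ t ∈ Finset.Icc 1 T, 0 ≤ invQuad b a x t ∧ invQuad b a x t ≤ 1 / b := by
  intro t
  induction t using Nat.strong_induction_on with
  | _ t ih =>
    intro ht
    have hb1 : 1 / b < 1 := by rw [div_lt_one] <;> linarith
    have hpos : ∀ s ∈ Finset.Icc 1 (t - 1), 0 ≤ a s := by
      intro s hs
      rw [Finset.mem_Icc] at hs ht
      have hs' : s ∈ Finset.Icc 1 T := Finset.mem_Icc.2 ⟨hs.1, by omega⟩
      rw [ha s hs']
      have := (ih s (by omega) hs').2
      exact one_div_nonneg.2 (by linarith)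
    exact ⟨invQuad_nonneg (by linarith) hpos, invQuad_le_inv (by linarith) hpos (hx t ht)⟩

/-- With s = rq ∈ [0,1], exp s ≤ 1 + s + s², and s² ≤ rq² because r ≤ 1. The factor 1 + q supplies
exactly this quadratic term. -/
theorem mul_le_log_one_add {q r : ℝ} (hq : 0 ≤ q) (hq1 : q ≤ 1) (hr : 0 ≤ r) (hr1 : r ≤ 1) :
    r * q ≤ Real.log (1 + r * (1 + q) * q) := by
  rw [Real.le_log_iff_exp_le (by positivity)]
  have hrq : r * q ≤ 1 := mul_le_one₀ hr1 hq hq1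
  have hrq0 : 0 ≤ r * q := mul_nonneg hr hq
  have h := (abs_le.1 (Real.abs_exp_sub_one_sub_id_le (abs_le.2 ⟨by linarith, hrq⟩))).2
  nlinarith [mul_nonneg (mul_nonneg hr (sq_nonneg q)) (sub_nonneg.2 hr1)]

/-- Adding a vector with coefficient `w (1 + q)` raises the log-determinant by at least `w q`. -/
theorem sum_mul_le_log_det (hb : 0 < b) {q : ℕ → ℝ}
    (hq : ∀ t ∈ Finset.Icc 1 T, 0 ≤ q t ∧ q t ≤ 1)
    (hw : ∀ t ∈ Finset.Icc 1 T, 0 ≤ w t ∧ w t ≤ 1)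
    (hqc : ∀ t ∈ Finset.Icc 1 T, q t ≤ invQuad b (fun s => w s * (1 + q s)) x t) :
    ∑ t ∈ Finset.Icc 1 T, w t * q t ≤
      Real.log (A b (fun s => w s * (1 + q s)) x T).det - d * Real.log b := by
  have hc : ∀ t ∈ Finset.Icc 1 T, 0 ≤ w t * (1 + q t) := fun t ht =>
    mul_nonneg (hw t ht).1 (by linarith [(hq t ht).1])
  induction T with
  | zero => simp [det_A_zero]
  | succ n ih =>
    have hsub : Finset.Icc 1 n ⊆ Finset.Icc 1 (n + 1) :=
      Finset.Icc_subset_Icc_right (Nat.le_succ n)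
    have hlast : n + 1 ∈ Finset.Icc 1 (n + 1) := Finset.mem_Icc.2 ⟨by omega, le_rfl⟩
    specialize ih (fun t ht => hq t (hsub ht)) (fun t ht => hw t (hsub ht))
      (fun t ht => hqc t (hsub ht)) (fun t ht => hc t (hsub ht))
    have hPD := A_posDef (x := x) hb fun t ht => hc t (hsub ht)
    obtain ⟨hq0, hq1⟩ := hq _ hlast
    obtain ⟨hw0, hw1⟩ := hw _ hlast
    have hqc' := hqc _ hlast
    have hinc : w (n + 1) * q (n + 1) ≤ Real.log (1 + w (n + 1) * (1 + q (n + 1)) *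
        invQuad b (fun s => w s * (1 + q s)) x (n + 1)) := by
      refine (mul_le_log_one_add hq0 hq1 hw0 hw1).trans (Real.log_le_log (by positivity) ?_)
      gcongr
    have hp : 0 < 1 + w (n + 1) * (1 + q (n + 1)) *
        invQuad b (fun s => w s * (1 + q s)) x (n + 1) := by
      have := mul_nonneg (hc _ hlast) (hq0.trans hqc')
      linarith
    rw [Finset.sum_Icc_succ_top (by omega), A_succ, det_add_smul_vecMulVec hPD.det_pos.ne'.isUnit]
    change _ ≤ Real.log (_ * (1 + w (n + 1) * (1 + q (n + 1)) *
        invQuad b (fun s => w s * (1 + q s)) x (n + 1))) - _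
    rw [Real.log_mul hPD.det_pos.ne' hp.ne']
    linarith

/-- The loss-sensitive elliptical potential bound. -/
theorem sum_mul_invQuad_le (hd : 0 < d) (hb : 1 < b) (hx : ∀ t ∈ Finset.Icc 1 T, ‖x t‖ ≤ 1)
    (ha : ∀ t ∈ Finset.Icc 1 T, a t = 1 / (1 - invQuad b a x t))
    (hw : ∀ t ∈ Finset.Icc 1 T, 0 ≤ w t ∧ w t ≤ 1) :
    ∑ t ∈ Finset.Icc 1 T, w t * invQuad b a x t ≤
      d * (1 + Real.log (1 + (∑ t ∈ Finset.Icc 1 T, w t) / d)) := by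
  have hb0 : 0 < b := by linarith
  have hd' : (0 : ℝ) < d := Nat.cast_pos.2 hd
  have hb1 : 1 / b < 1 := by rw [div_lt_one] <;> linarith
  have hQ := invQuad_mem hb hx ha
  set q := invQuad b a x
  have hq : ∀ t ∈ Finset.Icc 1 T, 0 ≤ q t ∧ q t ≤ 1 := fun t ht =>
    ⟨(hQ t ht).1, (hQ t ht).2.trans hb1.le⟩
  have hc : ∀ t ∈ Finset.Icc 1 T, 0 ≤ w t * (1 + q t) := fun t ht =>
    mul_nonneg (hw t ht).1 (by linarith [(hq t ht).1])
  have hca : ∀ t ∈ Finset.Icc 1 T, w t * (1 + q t) ≤ a t := by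
    intro t ht
    have h1 : q t < 1 := (hQ t ht).2.trans_lt hb1
    rw [ha t ht, le_div_iff₀ (by linarith)]
    -- The choice of c_t works because (1 + q)(1 - q) = 1 - q² ≤ 1.
    have h2 : w t * ((1 + q t) * (1 - q t)) ≤ 1 :=
      mul_le_one₀ (hw t ht).2 (mul_nonneg (by linarith [(hq t ht).1]) (by linarith))
        (by nlinarith [sq_nonneg (q t)])
    linarith
  have hsub : ∀ t ∈ Finset.Icc 1 T, ∀ s ∈ Finset.Icc 1 (t - 1), s ∈ Finset.Icc 1 T := by
    intro t ht s hs
    rw [Finset.mem_Icc] at *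
    omega
  have hlog := sum_mul_le_log_det (x := x) hb0 hq hw fun t ht =>
    invQuad_anti hb0 (fun s hs => hc s (hsub t ht s hs)) fun s hs => hca s (hsub t ht s hs)
  set N := ∑ t ∈ Finset.Icc 1 T, w t
  have hN : 0 ≤ N := Finset.sum_nonneg fun t ht => (hw t ht).1
  have htr : (A b (fun s => w s * (1 + q s)) x T).trace ≤
      Fintype.card (Fin d) * (b + 2 * N / d) := by
    have hs : ∑ s ∈ Finset.Icc 1 T, w s * (1 + q s) * ‖x s‖ ^ 2 ≤ 2 * N := by
      rw [Finset.mul_sum]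
      refine Finset.sum_le_sum fun s hs => ?_
      have h1 : ‖x s‖ ^ 2 ≤ 1 := pow_le_one₀ (norm_nonneg _) (hx s hs)
      calc w s * (1 + q s) * ‖x s‖ ^ 2 ≤ w s * (1 + q s) :=
            mul_le_of_le_one_right (hc s hs) h1
        _ ≤ 2 * w s := by nlinarith [(hw s hs).1, (hq s hs).2]
    rw [trace_A, Fintype.card_fin, mul_add, mul_div_cancel₀ _ hd'.ne']
    linarith
  have hdet := log_det_le (A_posDef hb0 hc) (by positivity) htr
  rw [Fintype.card_fin] at hdet
  have hfin : Real.log (b + 2 * N / d) ≤ Real.log b + (1 + Real.log (1 + N / d)) := by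
    have h : Real.log (b * (Real.exp 1 * (1 + N / d))) =
        Real.log b + (1 + Real.log (1 + N / d)) := by
      rw [Real.log_mul (by positivity) (by positivity),
        Real.log_mul (by positivity) (by positivity), Real.log_exp]
    rw [← h]
    refine Real.log_le_log (by positivity) ?_
    -- The summand 1 in the bound is log e, which absorbs the factor 2 from 1 + q_t ≤ 2.
    have he : 2 ≤ Real.exp 1 := by linarith [Real.add_one_le_exp 1]
    have hz : 0 ≤ N / d := by positivity
    calc b + 2 * N / d = b + 2 * (N / d) := by ring
      _ ≤ b * (2 * (1 + N / d)) := by nlinarith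
      _ ≤ b * (Real.exp 1 * (1 + N / d)) := by gcongr
  have := mul_le_mul_of_nonneg_left hfin hd'.le
  linarith

theorem instLoss_le_supLoss (y : ℕ → ℝ) (u : EuclideanSpace ℝ (Fin d)) (ht : t ∈ Finset.Icc 1 T) :
    instLoss x y t u ≤ supLoss x y T u :=
  le_csSup ((Set.finite_Icc 1 T).image _).bddAbove ⟨t, by simpa using ht, rfl⟩

theorem weightedLoss_eq (y : ℕ → ℝ) (u : EuclideanSpace ℝ (Fin d)) :
    weightedLoss a x y T u =
      cumLoss x y T u + ∑ t ∈ Finset.Icc 1 T, (a t - 1) * instLoss x y t u := by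
  rw [weightedLoss, cumLoss, ← Finset.sum_add_distrib]
  refine Finset.sum_congr rfl fun t _ => ?_
  rw [instLoss, real_inner_comm]
  ring

theorem weight_sub_one_le {q : ℝ} (hb : 1 < b) (hq : 0 ≤ q) (hqb : q ≤ 1 / b) :
    1 / (1 - q) - 1 ≤ b / (b - 1) * q := by
  have hb1 : 1 / b < 1 := by rw [div_lt_one] <;> linarith
  have hqb' : q * b ≤ 1 := (le_div_iff₀ (by linarith)).1 hqb
  have h : 1 / (1 - q) - 1 = 1 / (1 - q) * q := by
    have : 1 - q ≠ 0 := by linarith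
    field_simp
    ring
  rw [h]
  refine mul_le_mul_of_nonneg_right ?_ hq
  rw [div_le_div_iff₀ (by linarith) (by linarith)]
  linarith

end WEMM

theorem theorem6 {d : ℕ} (T : ℕ) (b : ℝ) (x : ℕ → EuclideanSpace ℝ (Fin d)) (y a : ℕ → ℝ)
    (hx : ∀ t ∈ Finset.Icc 1 T, ‖x t‖ ≤ 1)
    (hb : 1 < b)
    (ha : ∀ t ∈ Finset.Icc 1 T, a t = 1 / (1 - WEMM.invQuad b a x t))
    (u : EuclideanSpace ℝ (Fin d)) :
    WEMM.weightedLoss a x y T u ≤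
      WEMM.cumLoss x y T u +
        b / (b - 1) * WEMM.supLoss x y T u * d *
          (1 + Real.log (1 + WEMM.cumLoss x y T u / (WEMM.supLoss x y T u * d))) := by
  have hQ := WEMM.invQuad_mem hb hx ha
  have hβ : 0 ≤ b / (b - 1) := div_nonneg (by linarith) (by linarith)
  have hl : ∀ t, 0 ≤ WEMM.instLoss x y t u := fun t => sq_nonneg _
  have hlS : ∀ t ∈ Finset.Icc 1 T, WEMM.instLoss x y t u ≤ WEMM.supLoss x y T u :=
    fun t ht => WEMM.instLoss_le_supLoss y u ht
  set S := WEMM.supLoss x y T u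
  rw [WEMM.weightedLoss_eq, add_le_add_iff_left]
  have hS0 : 0 ≤ S := Real.sSup_nonneg (by rintro _ ⟨t, -, rfl⟩; exact hl t)
  have hsum : ∑ t ∈ Finset.Icc 1 T, (a t - 1) * WEMM.instLoss x y t u ≤
      b / (b - 1) * ∑ t ∈ Finset.Icc 1 T, WEMM.instLoss x y t u * WEMM.invQuad b a x t := by
    rw [Finset.mul_sum]
    refine Finset.sum_le_sum fun t ht => ?_
    have h1 := WEMM.weight_sub_one_le hb (hQ t ht).1 (hQ t ht).2
    rw [← ha t ht] at h1
    linarith [mul_le_mul_of_nonneg_right h1 (hl t)]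
  -- If S = 0, all losses vanish and the factor S kills the last summand, whatever the logarithm is.
  rcases hS0.eq_or_lt with hS | hS
  · have hz : ∀ t ∈ Finset.Icc 1 T, WEMM.instLoss x y t u = 0 := fun t ht =>
      le_antisymm (hS ▸ hlS t ht) (hl t)
    rw [Finset.sum_eq_zero fun t ht => by rw [hz t ht, mul_zero], ← hS]
    simp
  · refine hsum.trans ?_
    rcases Nat.eq_zero_or_pos d with rfl | hd
    · simp [WEMM.invQuad]
    · have hw : ∀ t ∈ Finset.Icc 1 T,
          0 ≤ WEMM.instLoss x y t u / S ∧ WEMM.instLoss x y t u / S ≤ 1 := fun t ht =>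
        ⟨div_nonneg (hl t) hS0, (div_le_one hS).2 (hlS t ht)⟩
      have h := WEMM.sum_mul_invQuad_le hd hb hx ha hw
      rw [← Finset.sum_div, div_div, ← WEMM.cumLoss] at h
      have heq : ∑ t ∈ Finset.Icc 1 T, WEMM.instLoss x y t u * WEMM.invQuad b a x t =
          S * ∑ t ∈ Finset.Icc 1 T, WEMM.instLoss x y t u / S * WEMM.invQuad b a x t := by
        rw [Finset.mul_sum]
        refine Finset.sum_congr rfl fun t _ => ?_
        field_simp
      rw [heq, mul_assoc, mul_assoc]
      gcongr
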